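/- Let $a>0$ be a real number and let $n\ge 0$ be an integer. For $b\in\mathbb{R}$ consider the hypergeometric polynomial $$r_{n+1}(z)=r_{n+1}(z;a,b):=\frac{(2a)_{n+1}}{(a)_{n+1}}\;{}_2F_1\!\left(-n-1,\,a+bi;\,2a;\,1-z\right),$$ where $(x)_k:=x(x+1)\cdots(x+k-1)$ and ${}_2F_1(A,B;C;w)=\sum_{k\ge 0}\frac{(A)_k(B)_k}{(C)_k\,k!}w^k$ (here the sum terminates at $k=n+1$). Then the zeros of $r_{n+1}$ lie on the unit circle $\mathbb{S}^1=\{z\in\mathbb{C}:|z|=1\}$ and move strictly clockwise along it as $b$ increases over $\mathbb{R}$. More precisely, for every $b$ the polynomial $r_{n+1}(\cdot\,;a,b)$ has degree $n+1$, and there are differentiable functions $\theta_0,\dots,\theta_n:\mathbb{R}\to(0,2\pi)$ such that, for every $b\in\mathbb{R}$, $\theta_0(b)<\theta_1(b)<\dots<\theta_n(b)$, the zeros of $r_{n+1}(\cdot\,;a,b)$, listed with multiplicity, are exactly $e^{i\theta_0(b)},\dots,e^{i\theta_n(b)}$ (in particular they are simple and different from $1$), and $\theta_k'(b)<0$ for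 all $k$; consequently each $\theta_k$ is strictly decreasing on $\mathbb{R}$. -/

import Mathlib

open Polynomial

/-- The hypergeometric polynomial
`r_{n+1}(z) = ((2a)_{n+1} / (a)_{n+1}) * ₂F₁(-n-1, a + b i; 2a; 1 - z)`,
as an element of `ℂ[X]`. The series terminates after the term of index `n + 1`, and
`ordinaryHypergeometricCoefficient A B C k` is `(A)_k (B)_k / ((C)_k k!)`. -/
noncomputable def hypergeometricPoly (a b : ℝ) (n : ℕ) : ℂ[X] :=
  C ((ascPochhammer ℂ (n + 1)).eval (2 * a : ℂ) / (ascPochhammer ℂ (n + 1)).eval (a : ℂ)) *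
    ∑ k ∈ Finset.range (n + 2),
      C (ordinaryHypergeometricCoefficient (-(n : ℂ) - 1) (a + b * Complex.I) (2 * a : ℂ) k) *
        (1 - X) ^ k

/-- The values of `hypergeometricPoly` are given by the hypergeometric function `₂F₁`. -/
theorem hypergeometricPoly_eval (a b : ℝ) (n : ℕ) (z : ℂ) :
    (hypergeometricPoly a b n).eval z =
      (ascPochhammer ℂ (n + 1)).eval (2 * a : ℂ) / (ascPochhammer ℂ (n + 1)).eval (a : ℂ) *
        ordinaryHypergeometric (-(n : ℂ) - 1) (a + b * Complex.I) (2 * a : ℂ) (1 - z) := by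
  have h : ordinaryHypergeometric (-(n : ℂ) - 1) (a + b * Complex.I) (2 * a : ℂ) (1 - z) =
      ∑ k ∈ Finset.range (n + 2),
        ordinaryHypergeometricCoefficient (-(n : ℂ) - 1) (a + b * Complex.I) (2 * a : ℂ) k *
          (1 - z) ^ k := by
    rw [ordinaryHypergeometric_eq_tsum]
    simp only [smul_eq_mul]
    refine (tsum_eq_sum (s := Finset.range (n + 2)) fun k hk => ?_)
    have hk' : n + 1 < k := by
      have : n + 2 ≤ k := by simpa using hk
      omega
    have h0 : (ascPochhammer ℂ k).eval (-(n : ℂ) - 1) = 0 := by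
      have := ascPochhammer_eval_neg_coe_nat_of_lt (R := ℂ) hk'
      rw [← this]; push_cast; ring_nf
    simp [h0]
  rw [h]
  simp [hypergeometricPoly, eval_finsetSum, ordinaryHypergeometricCoefficient]

/-! On the circle put `z = (x + i)/(x - i)` with `x = cot (θ/2)` real; this omits exactly `z = 1`.
After multiplication by `(x - i)^m (2a)_m`, the contiguous relation in the first parameter becomes a
three-term recurrence with real coefficients, so the zeros are governed by real polynomials `cotPoly
a b m` (`hypergeometricSum_eq_cotPoly`).

The coefficient of the lower term is negative, so these form a Sturm sequence: `cotPoly a b (n + 1)`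
has `n + 1` simple real zeros (`exists_roots_of_sturm`). The same recurrence makes the Wronskian in
`b` of consecutive members negative (`cotPoly_wronskian_neg`). Hence implicit differentiation shows
each real zero increasing in `b`, and `θ = π - 2 arctan x` decreases. -/

/-! ### Real polynomials: product form and signs -/

/-- A nonzero polynomial of degree at most `card ι` vanishing at the values of an injective family
indexed by `ι` has exactly these values as its roots. -/
theorem Polynomial.roots_eq_map_univ {K ι : Type*} [Field K] [Fintype ι] {p : K[X]} (hp : p ≠ 0)
    (hdeg : p.natDegree ≤ Fintype.card ι) {t : ι → K} (ht : Function.Injective t)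
    (hroot : ∀ i, p.eval (t i) = 0) :
    p.natDegree = Fintype.card ι ∧ p.roots = Finset.univ.val.map t := by
  have hle : Finset.univ.val.map t ≤ p.roots := by
    rw [Multiset.le_iff_subset ((Multiset.nodup_map_iff_of_injective ht).2 Finset.univ.nodup)]
    intro z hz
    obtain ⟨i, -, rfl⟩ := Multiset.mem_map.1 hz
    exact (mem_roots hp).2 (hroot i)
  have hcard : (Finset.univ.val.map t).card = Fintype.card ι := by simp
  have hroots := p.card_roots'
  have hle' := Multiset.card_le_card hle
  refine ⟨by omega, (Multiset.eq_of_le_of_card_le hle (by omega)).symm⟩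

/-- A polynomial with a full injective family of roots splits as a product. -/
theorem Polynomial.eq_C_mul_nodal {K ι : Type*} [Field K] [Fintype ι] {p : K[X]} (hp : p ≠ 0)
    (hdeg : p.natDegree ≤ Fintype.card ι) {t : ι → K} (ht : Function.Injective t)
    (hroot : ∀ i, p.eval (t i) = 0) :
    p = C p.leadingCoeff * Lagrange.nodal Finset.univ t := by
  obtain ⟨h1, h2⟩ := roots_eq_map_univ hp hdeg ht hroot
  have := C_leadingCoeff_mul_prod_multiset_X_sub_C (p := p) (by rw [h1, h2]; simp)
  rw [h2, Multiset.map_map] at this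
  exact this.symm

theorem Finset.prod_sign_pos {ι : Type*} (s : Finset ι) (f : ι → ℝ) (hf : ∀ i ∈ s, f i ≠ 0) :
    0 < (-1 : ℝ) ^ (s.filter fun i => f i < 0).card * ∏ i ∈ s, f i := by
  classical
  induction s using Finset.induction_on with
  | empty => simp
  | insert i s hi ih =>
    have ih := ih fun j hj => hf j (Finset.mem_insert_of_mem hj)
    rw [Finset.prod_insert hi, Finset.filter_insert]
    split_ifs with h
    · rw [Finset.card_insert_of_notMem (by simp [hi]), pow_succ]
      nlinarith
    · have : 0 < f i := lt_of_le_of_ne (not_lt.1 h) (hf i (Finset.mem_insert_self i s)).symm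
      nlinarith

/-- Exactly `N - j` zeros lie to the right of `y`, and each gives a negative factor in the product
form. -/
theorem eval_sign_of_between {N : ℕ} {p : ℝ[X]} (hlead : 0 < p.leadingCoeff)
    (hdeg : p.natDegree ≤ N) {t : Fin N → ℝ} (ht : StrictMono t)
    (hroot : ∀ i, p.eval (t i) = 0) (j : ℕ) (hj : j ≤ N) (y : ℝ)
    (hlt : ∀ k : Fin N, (k : ℕ) < j → t k < y) (hgt : ∀ k : Fin N, j ≤ (k : ℕ) → y < t k) :
    0 < (-1 : ℝ) ^ (N - j) * p.eval y := by
  have hp : p ≠ 0 := by rintro rfl; simp at hlead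
  rw [eq_C_mul_nodal hp (by simpa using hdeg) ht.injective hroot, eval_mul, eval_C,
    Lagrange.eval_nodal]
  have h := Finset.prod_sign_pos Finset.univ (fun k => y - t k) fun k _ => by
    rcases lt_or_ge (k : ℕ) j with h | h
    · exact (sub_pos.2 (hlt k h)).ne'
    · exact (sub_neg.2 (hgt k h)).ne
  have hc : (Finset.univ.filter fun k => y - t k < 0).card = N - j := by
    have : (Finset.univ.filter fun k : Fin N => y - t k < 0) =
        Finset.univ.filter fun k : Fin N => ¬ (k : ℕ) < j := by
      refine Finset.filter_congr fun k _ => ⟨fun h h' => ?_, fun h => ?_⟩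
      · linarith [hlt k h']
      · exact sub_neg.2 (hgt k (not_lt.1 h))
    have h2 := Finset.card_filter_add_card_filter_not (s := (Finset.univ : Finset (Fin N)))
      (fun k : Fin N => (k : ℕ) < j)
    rw [Fin.card_filter_val_lt, Finset.card_univ, Fintype.card_fin] at h2
    rw [this]
    omega
  rw [hc] at h
  have := mul_pos hlead h
  linarith

/-- At a node the derivative is the leading coefficient times the product of differences to the
other nodes, of which `N - 1 - k` are negative. -/
theorem eval_derivative_sign_of_strictMono {N : ℕ} {p : ℝ[X]} (hlead : 0 < p.leadingCoeff)
    (hdeg : p.natDegree ≤ N) {t : Fin N → ℝ} (ht : StrictMono t)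
    (hroot : ∀ i, p.eval (t i) = 0) (k : Fin N) :
    0 < (-1 : ℝ) ^ (N - 1 - k) * p.derivative.eval (t k) := by
  have hp : p ≠ 0 := by rintro rfl; simp at hlead
  rw [eq_C_mul_nodal hp (by simpa using hdeg) ht.injective hroot, derivative_C_mul, eval_mul,
    eval_C, Lagrange.eval_nodal_derivative_eval_node_eq (Finset.mem_univ k), Lagrange.eval_nodal]
  have h := Finset.prod_sign_pos (Finset.univ.erase k) (fun i => t k - t i) fun i hi =>
    sub_ne_zero.2 (ht.injective.ne (Finset.ne_of_mem_erase hi).symm)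
  have hc : ((Finset.univ.erase k).filter fun i => t k - t i < 0) = Finset.Ioi k := by
    ext i
    simp only [Finset.mem_filter, Finset.mem_erase, Finset.mem_univ, sub_neg, ht.lt_iff_lt,
      Finset.mem_Ioi, and_true]
    exact ⟨fun h => h.2, fun h => ⟨h.ne', h⟩⟩
  rw [hc, Fin.card_Ioi] at h
  have := mul_pos hlead h
  linarith

/-- A polynomial of degree `N` with positive leading coefficient has sign `(-1) ^ N` far to the
left and is positive far to the right. -/
theorem exists_sign_at_infinity {p : ℝ[X]} (hlead : 0 < p.leadingCoeff) (l r : ℝ) :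
    (∃ y < l, 0 < (-1 : ℝ) ^ p.natDegree * p.eval y) ∧ ∃ y > r, 0 < p.eval y := by
  have key : ∀ q : ℝ[X], 0 < q.leadingCoeff → ∀ r : ℝ, ∃ y > r, 0 < q.eval y := by
    intro q hq r
    rcases Nat.eq_zero_or_pos q.natDegree with h | h
    · rw [eq_C_of_natDegree_eq_zero h] at hq ⊢
      exact ⟨r + 1, by simp, by simpa using hq⟩
    · have := q.tendsto_atTop_of_leadingCoeff_nonneg (natDegree_pos_iff_degree_pos.1 h) hq.le
      obtain ⟨y, hy⟩ := ((Filter.eventually_gt_atTop r).and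
        (this.eventually (Filter.eventually_gt_atTop 0))).exists
      exact ⟨y, hy.1, hy.2⟩
  refine ⟨?_, key p hlead r⟩
  obtain ⟨y, hy, h⟩ := key (C ((-1 : ℝ) ^ p.natDegree) * p.comp (-X)) (by
    rw [leadingCoeff_mul, leadingCoeff_C, leadingCoeff_comp (by simp), leadingCoeff_neg,
      leadingCoeff_X]
    have : (-1 : ℝ) ^ p.natDegree * (-1) ^ p.natDegree = 1 := by rw [← mul_pow]; simp
    nlinarith) (-l)
  exact ⟨-y, by linarith, by simpa using h⟩

/-! ### Sturm sequences -/

/-- The zeros of a Sturm sequence of real polynomials are real and simple, and consecutive members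
alternate in sign at them. -/
theorem exists_roots_of_sturm {p : ℕ → ℝ[X]} (hdeg : ∀ m, (p m).natDegree = m)
    (hlead : ∀ m, 0 < (p m).leadingCoeff) {A B : ℕ → ℝ → ℝ} (hB : ∀ m x, 0 < B m x)
    (hrec : ∀ m x, (p (m + 2)).eval x = A m x * (p (m + 1)).eval x - B m x * (p m).eval x)
    (m : ℕ) :
    ∃ t : Fin (m + 1) → ℝ, StrictMono t ∧ ∀ k, (p (m + 1)).eval (t k) = 0 ∧
      0 < (-1 : ℝ) ^ (m - k) * (p m).eval (t k) := by
  -- Alternating signs at `m + 2` points give one zero in each of the `m + 1` gaps, by the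
  -- intermediate value theorem.
  have step : ∀ m (y : ℕ → ℝ), (∀ j ≤ m, y j < y (j + 1)) →
      (∀ j ≤ m + 1, 0 < (-1 : ℝ) ^ (m + 1 - j) * (p (m + 1)).eval (y j)) →
      ∃ t : Fin (m + 1) → ℝ, StrictMono t ∧ (∀ k, (p (m + 1)).eval (t k) = 0) ∧
        ∀ k : Fin (m + 1), y k < t k ∧ t k < y (k + 1) := by
    intro m y hy hs
    have hex : ∀ k : Fin (m + 1), ∃ z, (y k < z ∧ z < y (k + 1)) ∧ (p (m + 1)).eval z = 0 := by
      intro k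
      have h1 := hs k (by omega)
      have h2 := hs (k + 1) (by omega)
      have hpow : (-1 : ℝ) ^ (m + 1 - (k : ℕ)) = - (-1) ^ (m + 1 - (k + 1 : ℕ)) := by
        rw [show m + 1 - (k : ℕ) = m + 1 - (k + 1) + 1 by omega, pow_succ]; ring
      have hc : ContinuousOn (fun z => (-1 : ℝ) ^ (m + 1 - (k + 1 : ℕ)) * (p (m + 1)).eval z)
        (Set.Icc (y k) (y (k + 1))) := by fun_prop
      obtain ⟨z, hz, hz0⟩ := intermediate_value_Ioo (hy k (by omega)).le hc
        (show (0 : ℝ) ∈ _ from ⟨by rw [hpow] at h1; linarith, h2⟩)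
      exact ⟨z, hz, (mul_eq_zero.1 hz0).resolve_left (by simp)⟩
    choose t ht ht0 using hex
    refine ⟨t, ?_, ht0, ht⟩
    rw [Fin.strictMono_iff_lt_succ]
    intro i
    have h1 := (ht i.castSucc).2
    have h2 := (ht i.succ).1
    simp only [Fin.val_castSucc, Fin.val_succ] at h1 h2
    exact h1.trans h2
  induction m with
  | zero =>
    have h0 : ∀ x, 0 < (p 0).eval x := fun x => by
      have := hlead 0
      rw [eq_C_of_natDegree_eq_zero (hdeg 0)] at this ⊢
      simpa using this
    obtain ⟨⟨l, hl, hl'⟩, r, hr, hr'⟩ := exists_sign_at_infinity (hlead 1) 0 0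
    obtain ⟨t, ht, ht0, -⟩ := step 0 (fun j => if j = 0 then l else r)
      (by intro j hj; obtain rfl : j = 0 := by omega
          simpa using hl.trans hr)
      (by intro j hj
          interval_cases j
          · simpa [hdeg] using hl'
          · simpa using hr')
    exact ⟨t, ht, fun k => ⟨ht0 k, by simpa using h0 (t k)⟩⟩
  | succ m ih =>
    obtain ⟨x, hx, hx0⟩ := ih
    obtain ⟨⟨l, hl, hl'⟩, r, hr, hr'⟩ :=
      exists_sign_at_infinity (hlead (m + 2)) (x 0) (x (Fin.last m))
    -- The test points are the zeros of the previous polynomial, shifted by one index, flanked by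
    -- far points `l` and `r`.
    let y : ℕ → ℝ := fun j => if j = 0 then l else if h : j - 1 < m + 1 then x ⟨j - 1, h⟩ else r
    have hyx : ∀ k : Fin (m + 1), y (k + 1) = x k := fun k => by
      simp only [y, Nat.add_eq_zero_iff, one_ne_zero, and_false, if_false, Nat.add_sub_cancel,
        k.isLt, dif_pos]
    have hy0 : y 0 = l := by simp [y]
    have hyr : y (m + 2) = r := by simp [y]
    obtain ⟨t, ht, ht0, hty⟩ := step (m + 1) y (by
        intro j hj
        rcases Nat.eq_zero_or_pos j with rfl | hj0
        · rw [hy0]; simpa using hl.trans_eq (hyx 0).symm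
        · obtain ⟨i, rfl⟩ := Nat.exists_eq_add_of_lt hj0
          rw [zero_add] at *
          rcases Nat.lt_or_ge i m with him | him
          · rw [hyx ⟨i, by omega⟩, hyx ⟨i + 1, by omega⟩]
            exact hx (by simp)
          · obtain rfl : i = m := by omega
            rw [hyr]; exact (hyx (Fin.last i)).trans_lt hr)
      (by
        intro j hj
        rcases Nat.eq_zero_or_pos j with rfl | hj0
        · rw [hy0]; simpa [hdeg] using hl'
        · obtain ⟨i, rfl⟩ := Nat.exists_eq_add_of_lt hj0
          rw [zero_add] at *
          rcases Nat.lt_or_ge i (m + 1) with him | him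
          · obtain ⟨h1, h2⟩ := hx0 ⟨i, him⟩
            -- At a zero of `p (m + 1)` the recurrence leaves `p (m + 2) = -B * p m`, which flips
            -- the known sign.
            rw [hyx ⟨i, him⟩, hrec, h1]
            have := mul_pos (hB m (x ⟨i, him⟩)) h2
            simp only at this
            rw [show m + 1 + 1 - (i + 1) = m - i + 1 by omega, pow_succ]
            linarith
          · obtain rfl : i = m + 1 := by omega
            rw [hyr]; simpa using hr')
    refine ⟨t, ht, fun k => ⟨ht0 k, ?_⟩⟩
    -- By interlacing, exactly `k` zeros of `p (m + 1)` lie to the left of `t k`.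
    refine eval_sign_of_between (hlead (m + 1)) (hdeg (m + 1)).le hx (fun i => (hx0 i).1) k
      (by omega) _ (fun i hi => ?_) (fun i hi => ?_)
    · have h1 : (i : ℕ) + 1 ≤ k := hi
      rw [← hyx i]
      refine lt_of_le_of_lt ?_ (hty k).1
      obtain ⟨k', hk'⟩ : ∃ k' : Fin (m + 1), (k : ℕ) = k' + 1 :=
        ⟨⟨k - 1, by omega⟩, by simp; omega⟩
      rw [hk', hyx, hyx]
      exact hx.monotone (by rw [Fin.le_def]; omega)
    · refine (hty k).2.trans_le ?_
      have hk : (k : ℕ) < m + 1 := by omega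
      rw [hyx ⟨k, hk⟩]
      exact hx.monotone hi

/-! ### The real polynomials in the cotangent variable -/

/-- The real polynomial in `x = cot (θ / 2)` which is, up to the factor `(x - i) ^ m / (2a)_m`, the
value of `₂F₁(-m, a + b i; 2a; 1 - z)` at `z = exp (i θ) = (x + i) / (x - i)`. -/
noncomputable def cotPoly (a b : ℝ) : ℕ → ℝ[X]
  | 0 => 1
  | 1 => C (2 * a) * X - C (2 * b)
  | m + 2 => (C (2 * (a + m + 1)) * X - C (2 * b)) * cotPoly a b (m + 1) -
      C ((m + 1) * (2 * a + m)) * (1 + X ^ 2) * cotPoly a b m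

theorem cotPoly_eval_zero (a b x : ℝ) : (cotPoly a b 0).eval x = 1 := by simp [cotPoly]

theorem cotPoly_eval_one (a b x : ℝ) : (cotPoly a b 1).eval x = 2 * a * x - 2 * b := by
  simp [cotPoly]

theorem cotPoly_eval_add_two (a b x : ℝ) (m : ℕ) :
    (cotPoly a b (m + 2)).eval x = (2 * (a + m + 1) * x - 2 * b) * (cotPoly a b (m + 1)).eval x -
      (m + 1) * (2 * a + m) * (1 + x ^ 2) * (cotPoly a b m).eval x := by
  simp [cotPoly]

/-- The top coefficients combine through `2(a+m+1) - (m+1) = 2a+m+1`, the next Pochhammer factor, so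
for `a > 0` the degree never drops. -/
theorem cotPoly_natDegree_le_and_coeff (a b : ℝ) (m : ℕ) :
    (cotPoly a b m).natDegree ≤ m ∧
      (cotPoly a b m).coeff m = (ascPochhammer ℝ m).eval (2 * a) := by
  induction m using Nat.twoStepInduction with
  | zero => simp [cotPoly]
  | one =>
    refine ⟨?_, by simp [cotPoly]⟩
    rw [cotPoly]; compute_degree
  | more m ih0 ih1 =>
    have d1 : (C (2 * (a + m + 1)) * X - C (2 * b)).natDegree ≤ 1 := by compute_degree
    have d2 : (C ((m + 1) * (2 * a + m)) * (1 + X ^ 2)).natDegree ≤ 2 := by compute_degree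
    have c2 : (C ((m + 1) * (2 * a + m)) * (1 + X ^ 2)).coeff 2 = (m + 1) * (2 * a + m) := by
      simp only [coeff_C_mul, coeff_add, coeff_one, coeff_X_pow]
      norm_num
    have c1 : (C (2 * (a + m + 1)) * X - C (2 * b)).coeff 1 = 2 * (a + m + 1) := by
      simp
    constructor
    · rw [cotPoly]
      refine (natDegree_sub_le _ _).trans (max_le ?_ ?_)
      · exact (natDegree_mul_le_of_le d1 ih1.1).trans (by omega)
      · exact (natDegree_mul_le_of_le d2 ih0.1).trans (by omega)
    · rw [cotPoly, coeff_sub, show m + 2 = 1 + (m + 1) by omega,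
        coeff_mul_add_eq_of_natDegree_le d1 ih1.1, show 1 + (m + 1) = 2 + m by omega,
        coeff_mul_add_eq_of_natDegree_le d2 ih0.1, c1, c2, ih0.2, ih1.2,
        show 2 + m = m + 1 + 1 by omega, ascPochhammer_succ_eval (m + 1), ascPochhammer_succ_eval m]
      push_cast; ring

theorem cotPoly_natDegree_and_leadingCoeff {a : ℝ} (ha : 0 < a) (b : ℝ) (m : ℕ) :
    (cotPoly a b m).natDegree = m ∧ 0 < (cotPoly a b m).leadingCoeff := by
  obtain ⟨h1, h2⟩ := cotPoly_natDegree_le_and_coeff a b m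
  have h3 : 0 < (cotPoly a b m).coeff m := h2 ▸ ascPochhammer_pos m _ (by linarith)
  have h4 := le_antisymm h1 (le_natDegree_of_ne_zero h3.ne')
  exact ⟨h4, by rw [leadingCoeff, h4]; exact h3⟩

theorem contDiff_cotPoly_eval (a : ℝ) (m : ℕ) :
    ContDiff ℝ 1 (fun u : ℝ × ℝ => (cotPoly a u.1 m).eval u.2) := by
  induction m using Nat.twoStepInduction with
  | zero => simp only [cotPoly_eval_zero]; fun_prop
  | one => simp only [cotPoly_eval_one]; fun_prop
  | more m ih0 ih1 => simp only [cotPoly_eval_add_two]; fun_prop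

theorem differentiable_cotPoly_eval (a x : ℝ) (m : ℕ) :
    Differentiable ℝ (fun b => (cotPoly a b m).eval x) :=
  ((contDiff_cotPoly_eval a m).differentiable one_ne_zero).comp (f := fun b => (b, x))
    (by fun_prop)

/-- A Christoffel–Darboux type inequality for the derivative with respect to the parameter. -/
theorem cotPoly_wronskian_neg {a : ℝ} (ha : 0 < a) (b x : ℝ) (m : ℕ) :
    deriv (fun b => (cotPoly a b (m + 1)).eval x) b * (cotPoly a b m).eval x -
      deriv (fun b => (cotPoly a b m).eval x) b * (cotPoly a b (m + 1)).eval x < 0 := by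
  induction m with
  | zero =>
    have h : HasDerivAt (fun b : ℝ => 2 * a * x - 2 * b) (-(2 * 1)) b :=
      ((hasDerivAt_id b).const_mul 2).const_sub _
    simp [cotPoly_eval_zero, cotPoly_eval_one, h.deriv]
  | succ m ih =>
    set v0 := (cotPoly a b m).eval x with hv0
    set v1 := (cotPoly a b (m + 1)).eval x with hv1
    have h0 := (differentiable_cotPoly_eval a x m b).hasDerivAt
    have h1 := (differentiable_cotPoly_eval a x (m + 1) b).hasDerivAt
    have hl : HasDerivAt (fun b : ℝ => 2 * (a + m + 1) * x - 2 * b) (-(2 * 1)) b :=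
      ((hasDerivAt_id b).const_mul 2).const_sub _
    have h2 := (hl.mul h1).sub (h0.const_mul ((m + 1) * (2 * a + m) * (1 + x ^ 2)))
    have hfun : (fun b => (cotPoly a b (m + 1 + 1)).eval x) =
        ((fun b => 2 * (a + m + 1) * x - 2 * b) * fun b => (cotPoly a b (m + 1)).eval x) -
          fun b => (m + 1) * (2 * a + m) * (1 + x ^ 2) * (cotPoly a b m).eval x :=
      funext fun b => cotPoly_eval_add_two a b x m
    rw [hfun, h2.deriv, cotPoly_eval_add_two, ← hv0, ← hv1]
    set d0 := deriv (fun b => (cotPoly a b m).eval x) b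
    set d1 := deriv (fun b => (cotPoly a b (m + 1)).eval x) b
    -- The new Wronskian equals `-2 * v1 ^ 2` plus this positive factor times the old one.
    have hc : 0 < (m + 1) * (2 * a + m) * (1 + x ^ 2) := by positivity
    have := mul_neg_of_pos_of_neg hc ih
    nlinarith [sq_nonneg v1]

/-- The quotient is the velocity of a zero given by implicit differentiation. At the `k`-th zero the
`x`-derivative and `cotPoly a b n` share the sign `(-1)^(n-k)`, while the Wronskian reduces to the
`b`-derivative times `cotPoly a b n`, so the two derivatives have opposite signs. -/
theorem exists_cotPoly_roots {a : ℝ} (ha : 0 < a) (n : ℕ) (b : ℝ) :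
    ∃ t : Fin (n + 1) → ℝ, StrictMono t ∧ (∀ k, (cotPoly a b (n + 1)).eval (t k) = 0) ∧
      ∀ k, (cotPoly a b (n + 1)).derivative.eval (t k) ≠ 0 ∧
        0 < -(deriv (fun b => (cotPoly a b (n + 1)).eval (t k)) b /
          (cotPoly a b (n + 1)).derivative.eval (t k)) := by
  obtain ⟨t, ht, h⟩ := exists_roots_of_sturm
    (p := cotPoly a b) (A := fun m x => 2 * (a + m + 1) * x - 2 * b)
    (B := fun m x => (m + 1) * (2 * a + m) * (1 + x ^ 2))
    (fun m => (cotPoly_natDegree_and_leadingCoeff ha b m).1)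
    (fun m => (cotPoly_natDegree_and_leadingCoeff ha b m).2)
    (fun m x => by positivity) (fun m x => cotPoly_eval_add_two a b x m) n
  refine ⟨t, ht, fun k => (h k).1, fun k => ?_⟩
  obtain ⟨hdeg, hlead⟩ := cotPoly_natDegree_and_leadingCoeff ha b (n + 1)
  have h1 := eval_derivative_sign_of_strictMono hlead hdeg.le ht (fun i => (h i).1) k
  have h2 := (h k).2
  have h3 := cotPoly_wronskian_neg ha b (t k) n
  rw [Nat.add_sub_cancel] at h1
  rw [(h k).1, mul_zero, sub_zero] at h3
  generalize (cotPoly a b (n + 1)).derivative.eval (t k) = d at *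
  generalize deriv (fun b => (cotPoly a b (n + 1)).eval (t k)) b = e at *
  generalize (cotPoly a b n).eval (t k) = v at *
  have h4 : 0 < d * v := by
    have := mul_pos h1 h2
    have hs : (-1 : ℝ) ^ (n - (k : ℕ)) * (-1) ^ (n - (k : ℕ)) = 1 := by rw [← mul_pow]; simp
    calc 0 < _ := this
      _ = ((-1 : ℝ) ^ (n - (k : ℕ)) * (-1) ^ (n - (k : ℕ))) * (d * v) := by ring
      _ = d * v := by rw [hs, one_mul]
  have hv : v ≠ 0 := by rintro rfl; simp at h4
  refine ⟨by rintro rfl; simp at h4, ?_⟩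
  rw [← mul_div_mul_right _ _ hv]
  exact neg_pos.2 (div_neg_of_neg_of_pos h3 h4)

/-! ### Motion of the real zeros -/

/-- The real zeros depend differentiably on the parameter and have positive derivative. -/
theorem exists_differentiable_cotPoly_roots {a : ℝ} (ha : 0 < a) (n : ℕ) :
    ∃ t : ℝ → Fin (n + 1) → ℝ, (∀ b, StrictMono (t b)) ∧
      (∀ b k, (cotPoly a b (n + 1)).eval (t b k) = 0) ∧
      ∀ b k, ∃ d, 0 < d ∧ HasDerivAt (fun b => t b k) d b := by
  choose t ht h0 h1 using exists_cotPoly_roots ha n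
  refine ⟨t, ht, h0, fun b k => ?_⟩
  set f : ℝ × ℝ → ℝ := fun u => (cotPoly a u.1 (n + 1)).eval u.2 with hf
  have hloc : ∀ k, ∃ ψ : ℝ → ℝ, ψ b = t b k ∧ (∀ᶠ c in nhds b, f (c, ψ c) = 0) ∧
      ∃ d, 0 < d ∧ HasDerivAt ψ d b := by
    intro k
    have hs : HasStrictFDerivAt f (fderiv ℝ f (b, t b k)) (b, t b k) :=
      (contDiff_cotPoly_eval a (n + 1)).contDiffAt.hasStrictFDerivAt one_ne_zero
    have hx : fderiv ℝ f (b, t b k) (0, 1) = (cotPoly a b (n + 1)).derivative.eval (t b k) := by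
      have h2 : HasDerivAt (fun x : ℝ => (b, x)) (0, 1) (t b k) :=
        (hasDerivAt_const _ b).prodMk (hasDerivAt_id _)
      exact (hs.hasFDerivAt.comp_hasDerivAt (t b k) h2).unique
        ((cotPoly a b (n + 1)).hasDerivAt (t b k))
    have hb : fderiv ℝ f (b, t b k) (1, 0) =
        deriv (fun c => (cotPoly a c (n + 1)).eval (t b k)) b := by
      have h2 : HasDerivAt (fun c : ℝ => (c, t b k)) (1, 0) b :=
        (hasDerivAt_id _).prodMk (hasDerivAt_const b _)
      exact (hs.hasFDerivAt.comp_hasDerivAt b h2).deriv.symm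
    have hinv : (fderiv ℝ f (b, t b k) ∘L .inr ℝ ℝ ℝ).IsInvertible := by
      refine ⟨ContinuousLinearEquiv.unitsEquivAut ℝ (Units.mk0 _ (h1 b k).1), ?_⟩
      ext
      simp [hx]
    have hψ := hs.hasStrictFDerivAt_implicitFunctionOfProdDomain hinv
    have hψe := hs.eventually_apply_implicitFunctionOfProdDomain hinv
    have hψb := (hs.eventually_apply_eq_iff_implicitFunctionOfProdDomain hinv).self_of_nhds.1 rfl
    set ψ := hs.implicitFunctionOfProdDomain hinv
    have hfu : f (b, t b k) = 0 := h0 b k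
    rw [hfu] at hψe
    have hd := hψ.hasFDerivAt.differentiableAt.hasDerivAt
    refine ⟨ψ, hψb, hψe, _, ?_, hd⟩
    have h2 : HasDerivAt (fun c => (c, ψ c)) (1, deriv ψ b) b := (hasDerivAt_id b).prodMk hd
    have h3 := (hψb ▸ hs.hasFDerivAt : HasFDerivAt f (fderiv ℝ f (b, t b k)) (b, ψ b)).comp_hasDerivAt
      b h2
    have h4 := h3.unique ((hasDerivAt_const b (0 : ℝ)).congr_of_eventuallyEq hψe)
    rw [show ((1 : ℝ), deriv ψ b) = (1, 0) + deriv ψ b • (0, 1) by simp, map_add, map_smul, hx, hb,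
      smul_eq_mul] at h4
    refine lt_of_lt_of_eq (h1 b k).2 ?_
    rw [neg_eq_iff_eq_neg, div_eq_iff (h1 b k).1]
    linarith
  choose ψ hψb hψe d hd hψd using hloc
  refine ⟨d k, hd k, (hψd k).congr_of_eventuallyEq ?_⟩
  -- The zeros `t c` were chosen separately for each `c`, with no continuity. Near `b` the implicit
  -- branches stay ordered, so both families enumerate the same root set increasingly and must
  -- coincide.
  have hmono : ∀ᶠ c in nhds b, StrictMono fun k => ψ k c := by
    have h : ∀ i : Fin n, ∀ᶠ c in nhds b, ψ i.castSucc c < ψ i.succ c := fun i =>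
      (hψd _).continuousAt.eventually_lt (hψd _).continuousAt (by
        rw [hψb, hψb]; exact ht b i.castSucc_lt_succ)
    filter_upwards [Filter.eventually_all.2 h] with c hc
    exact Fin.strictMono_iff_lt_succ.2 hc
  filter_upwards [hmono, Filter.eventually_all.2 hψe] with c hc hc0
  obtain ⟨hdeg, hlead⟩ := cotPoly_natDegree_and_leadingCoeff ha c (n + 1)
  have hp : cotPoly a c (n + 1) ≠ 0 := by intro h; simp [h] at hlead
  have e1 := (roots_eq_map_univ hp (by simpa using hdeg.le) hc.injective hc0).2
  have e2 := (roots_eq_map_univ hp (by simpa using hdeg.le) (ht c).injective (h0 c)).2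
  have hrange : Set.range (t c) = Set.range fun k => ψ k c := by
    ext y
    have := congrArg (y ∈ ·) (e2.symm.trans e1)
    simpa only [Multiset.mem_map, Finset.mem_val, Finset.mem_univ, true_and, eq_iff_iff,
      Set.mem_range] using this
  exact congrFun (StrictMono.range_inj (ht c) hc |>.1 hrange) k

/-! ### The contiguous relation and the passage to real polynomials -/

/-- The sum of the first `N` terms of the hypergeometric series `₂F₁(A, B; D; w)`. -/
noncomputable def hypergeometricSum (N : ℕ) (A B D w : ℂ) : ℂ :=
  ∑ k ∈ Finset.range N, ordinaryHypergeometricCoefficient A B D k * w ^ k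

theorem hypergeometricSum_eq_of_le (m N : ℕ) (hN : m + 1 ≤ N) (B D w : ℂ) :
    hypergeometricSum N (-m) B D w = hypergeometricSum (m + 1) (-m) B D w := by
  refine (Finset.sum_subset (Finset.range_mono hN) fun k _ hk => ?_).symm
  have hk' : m < k := by simpa using hk
  simp [ascPochhammer_eval_neg_coe_nat_of_lt (R := ℂ) hk']

theorem ascPochhammer_eval_succ_left (z : ℂ) (k : ℕ) :
    (ascPochhammer ℂ (k + 1)).eval z = z * (ascPochhammer ℂ k).eval (z + 1) := by
  simp [ascPochhammer_succ_left]

/-- The telescoped form of the contiguous relation in the first parameter. -/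
theorem hypergeometricSum_contiguous_aux (A B D w : ℂ) (hD : ∀ k : ℕ, D + k ≠ 0) (N : ℕ) :
    (D - A) * hypergeometricSum (N + 1) (A - 1) B D w -
      (D - 2 * A) * hypergeometricSum (N + 1) A B D w -
      A * hypergeometricSum (N + 1) (A + 1) B D w +
      w * ((B - A) * hypergeometricSum (N + 1) A B D w +
        A * hypergeometricSum (N + 1) (A + 1) B D w) =
    ((B - A) * ordinaryHypergeometricCoefficient A B D N +
      A * ordinaryHypergeometricCoefficient (A + 1) B D N) * w ^ (N + 1) := by
  induction N with
  | zero => simp [hypergeometricSum, ordinaryHypergeometricCoefficient]; ring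
  | succ N ih =>
    have hs : ∀ A', hypergeometricSum (N + 1 + 1) A' B D w = hypergeometricSum (N + 1) A' B D w +
        ordinaryHypergeometricCoefficient A' B D (N + 1) * w ^ (N + 1) := fun A' =>
      Finset.sum_range_succ _ _
    rw [hs, hs, hs]
    have key : (D - A) * ordinaryHypergeometricCoefficient (A - 1) B D (N + 1) -
        (D - 2 * A) * ordinaryHypergeometricCoefficient A B D (N + 1) -
        A * ordinaryHypergeometricCoefficient (A + 1) B D (N + 1) +
        ((B - A) * ordinaryHypergeometricCoefficient A B D N +
        A * ordinaryHypergeometricCoefficient (A + 1) B D N) = 0 := by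
      have e1 : A * (ascPochhammer ℂ N).eval (A + 1) = (ascPochhammer ℂ N).eval A * (A + N) := by
        rw [← ascPochhammer_eval_succ_left, ascPochhammer_succ_eval]
      have e2 := ascPochhammer_eval_succ_left (A - 1) N
      rw [sub_add_cancel] at e2
      have hDN := hD N
      have hf : (N : ℂ) + 1 ≠ 0 := Nat.cast_add_one_ne_zero N
      have hp : (ascPochhammer ℂ N).eval D ≠ 0 := by
        clear ih hs e1 e2 hDN
        induction N with
        | zero => simp
        | succ N ih => rw [ascPochhammer_succ_eval]
                       exact mul_ne_zero (ih (Nat.cast_add_one_ne_zero N)) (hD N)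
      have hfac : (N.factorial : ℂ) ≠ 0 := Nat.cast_ne_zero.2 N.factorial_ne_zero
      simp only [ordinaryHypergeometricCoefficient, e2, ascPochhammer_succ_eval, Nat.factorial_succ]
      push_cast
      field_simp
      linear_combination ((-(A+1+N)*(B+N) + (D+N)*(N+1)) * (ascPochhammer ℂ N).eval B) * e1
    linear_combination ih + w ^ (N + 1) * key

/-- Taking `A = -(m + 1)` and truncating after index `m + 2` makes all three series complete and the
boundary term zero. -/
theorem hypergeometricSum_contiguous (m : ℕ) (B D w : ℂ) (hD : ∀ k : ℕ, D + k ≠ 0) :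
    (D + (m + 1)) * hypergeometricSum (m + 3) (-(m + 2 : ℕ)) B D w =
      (D + 2 * (m + 1) - w * (B + (m + 1))) * hypergeometricSum (m + 2) (-(m + 1 : ℕ)) B D w -
        (m + 1) * (1 - w) * hypergeometricSum (m + 1) (-(m : ℕ)) B D w := by
  have h := hypergeometricSum_contiguous_aux (-(m + 1 : ℕ)) B D w hD (m + 2)
  have z0 : ordinaryHypergeometricCoefficient (-(m + 1 : ℕ) : ℂ) B D (m + 2) = 0 := by
    rw [ordinaryHypergeometricCoefficient,
      ascPochhammer_eval_neg_coe_nat_of_lt (R := ℂ) (show m + 1 < m + 2 by omega)]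
    simp
  have z1 : ordinaryHypergeometricCoefficient (-(m : ℕ) : ℂ) B D (m + 2) = 0 := by
    rw [ordinaryHypergeometricCoefficient,
      ascPochhammer_eval_neg_coe_nat_of_lt (R := ℂ) (show m < m + 2 by omega)]
    simp
  rw [show (-(m + 1 : ℕ) : ℂ) - 1 = -(m + 2 : ℕ) by push_cast; ring,
    show (-(m + 1 : ℕ) : ℂ) + 1 = -(m : ℕ) by push_cast; ring, z0, z1,
    hypergeometricSum_eq_of_le (m + 1) (m + 2 + 1) (by omega),
    hypergeometricSum_eq_of_le m (m + 2 + 1) (by omega)] at h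
  push_cast at h ⊢
  linear_combination h

/-- On the unit circle the hypergeometric polynomial is a multiple of a real polynomial in
`cot (θ / 2)`. -/
theorem hypergeometricSum_eq_cotPoly {a : ℝ} (ha : 0 < a) (b x : ℝ) (w : ℂ)
    (hw : w * (x - Complex.I) = -2 * Complex.I) (m : ℕ) :
    (x - Complex.I) ^ m * (ascPochhammer ℂ m).eval (2 * a : ℂ) *
      hypergeometricSum (m + 1) (-(m : ℕ)) (a + b * Complex.I) (2 * a) w =
      ((cotPoly a b m).eval x : ℝ) := by
  have hD : ∀ k : ℕ, (2 * a : ℂ) + k ≠ 0 := fun k => by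
    have : (0 : ℝ) < 2 * a + k := by positivity
    exact_mod_cast this.ne'
  have hI := Complex.I_sq
  induction m using Nat.twoStepInduction with
  | zero => simp [hypergeometricSum, cotPoly_eval_zero, ordinaryHypergeometricCoefficient]
  | one =>
    have ha' : (a : ℂ) ≠ 0 := Complex.ofReal_ne_zero.2 ha.ne'
    simp only [hypergeometricSum, Finset.sum_range_succ, cotPoly_eval_one,
      ordinaryHypergeometricCoefficient]
    simp
    field_simp
    linear_combination (-(a + b * Complex.I)) * hw + 2 * b * hI
  | more m ih0 ih1 =>
    have h := hypergeometricSum_contiguous m (a + b * Complex.I) (2 * a) w hD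
    have h1 : (((cotPoly a b (m + 2)).eval x : ℝ) : ℂ) =
        (2 * (a + m + 1) * x - 2 * b) * ((cotPoly a b (m + 1)).eval x : ℝ) -
        (m + 1) * (2 * a + m) * (1 + x ^ 2) * ((cotPoly a b m).eval x : ℝ) := by
      rw [cotPoly_eval_add_two]; push_cast; ring
    rw [h1, ← ih0, ← ih1, ascPochhammer_succ_eval (m + 1), ascPochhammer_succ_eval m]
    clear ih0 ih1 h1
    generalize hypergeometricSum (m + 2 + 1) _ _ _ _ = F2 at *
    generalize hypergeometricSum (m + 1 + 1) _ _ _ _ = F1 at *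
    generalize hypergeometricSum (m + 1) _ _ _ _ = F0 at *
    generalize (ascPochhammer ℂ m).eval (2 * a : ℂ) = P
    push_cast
    -- The powers of `x - i` clear the denominators of `w` and turn the contiguous coefficients into
    -- the real ones of `cotPoly`.
    have e1 : (x - Complex.I) * (2 * a + 2 * (m + 1) - w * (a + b * Complex.I + (m + 1))) =
        2 * (a + m + 1) * x - 2 * b := by
      linear_combination (-(a + b * Complex.I + (m + 1))) * hw + 2 * b * hI
    have e0 : (x - Complex.I) ^ 2 * (1 - w) = 1 + x ^ 2 := by
      linear_combination (-(x - Complex.I)) * hw - hI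
    rw [← e1, ← e0]
    linear_combination (x - Complex.I) ^ (m + 2) * P * (2 * a + m) * h

/-! ### Return to the unit circle -/

/-- This is `1 - z = -2i/(x - i)` for `x = cot (θ/2)`, cleared of its denominator. -/
theorem exp_pi_sub_two_arctan (x : ℝ) :
    (1 - Complex.exp ((Real.pi - 2 * Real.arctan x : ℝ) * Complex.I)) * (x - Complex.I) =
      -2 * Complex.I := by
  have hx := Real.tan_mul_cos (Real.cos_arctan_pos x).ne'
  have hs := Real.sin_sq_add_cos_sq (Real.arctan x)
  have hc := (Real.cos_arctan_pos x).ne'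
  have hI := Complex.I_sq
  rw [Real.tan_arctan] at hx
  rw [Complex.exp_mul_I, ← Complex.ofReal_cos, ← Complex.ofReal_sin, Real.cos_pi_sub,
    Real.sin_pi_sub, Real.cos_two_mul, Real.sin_two_mul]
  generalize Real.cos (Real.arctan x) = c at *
  generalize Real.sin (Real.arctan x) = s at *
  subst hx
  refine mul_right_cancel₀ (Complex.ofReal_ne_zero.2 hc) ?_
  have hs' : ((x : ℂ) * c) ^ 2 + (c : ℂ) ^ 2 = 1 := by exact_mod_cast hs
  push_cast
  linear_combination (-2 * Complex.I * c) * hs' + 2 * (c : ℂ) ^ 3 * x * hI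

theorem exp_mul_I_injOn_Ioo {α β : ℝ} (h1 : α ∈ Set.Ioo 0 (2 * Real.pi))
    (h2 : β ∈ Set.Ioo 0 (2 * Real.pi))
    (h : Complex.exp (α * Complex.I) = Complex.exp (β * Complex.I)) : α = β := by
  obtain ⟨N, hN⟩ := Complex.exp_eq_exp_iff_exists_int.1 h
  have hN' : α = β + N * (2 * Real.pi) := by simpa using congrArg Complex.im hN
  have hpi := Real.pi_pos
  have hlt : (N : ℝ) < 1 := by
    by_contra! h
    nlinarith [h1.1, h1.2, h2.1, h2.2]
  have hgt : (-1 : ℝ) < N := by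
    by_contra! h
    nlinarith [h1.1, h1.2, h2.1, h2.2]
  have hN0 : N = 0 := by
    have h3 : N < 1 := by exact_mod_cast hlt
    have h4 : -1 < N := by exact_mod_cast hgt
    omega
  simpa [hN0] using hN'

theorem hypergeometricPoly_eval_eq_sum (a b : ℝ) (n : ℕ) (z : ℂ) :
    (hypergeometricPoly a b n).eval z =
      (ascPochhammer ℂ (n + 1)).eval (2 * a : ℂ) / (ascPochhammer ℂ (n + 1)).eval (a : ℂ) *
        hypergeometricSum (n + 1 + 1) (-(n + 1 : ℕ)) (a + b * Complex.I) (2 * a) (1 - z) := by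
  rw [show (-(n + 1 : ℕ) : ℂ) = -(n : ℂ) - 1 by push_cast; ring]
  simp [hypergeometricPoly, eval_finsetSum, hypergeometricSum]

theorem ascPochhammer_eval_ofReal_ne_zero {a : ℝ} (ha : 0 < a) (m : ℕ) :
    (ascPochhammer ℂ m).eval (a : ℂ) ≠ 0 := by
  have := (ascPochhammer_pos m a ha).ne'
  rw [← ascPochhammer_map Complex.ofRealHom, eval_map, ← Complex.ofRealHom_eq_coe, eval₂_at_apply]
  exact Complex.ofReal_ne_zero.2 this

/-- At `z = 1` the series is `1`, leaving the nonzero prefactor. With the degree bound, `n + 1`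
distinct zeros then force the exact degree. -/
theorem hypergeometricPoly_ne_zero {a : ℝ} (ha : 0 < a) (b : ℝ) (n : ℕ) :
    hypergeometricPoly a b n ≠ 0 := by
  intro h
  have h1 := hypergeometricPoly_eval a b n 1
  have h2 := ascPochhammer_eval_ofReal_ne_zero ha (n + 1)
  have h3 := ascPochhammer_eval_ofReal_ne_zero (a := 2 * a) (by positivity) (n + 1)
  push_cast at h3
  rw [h, sub_self, ordinaryHypergeometric_zero, eval_zero, mul_one] at h1
  exact div_ne_zero h3 h2 h1.symm

theorem hypergeometricPoly_natDegree_le (a b : ℝ) (n : ℕ) :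
    (hypergeometricPoly a b n).natDegree ≤ n + 1 := by
  refine (natDegree_C_mul_le _ _).trans (natDegree_sum_le_of_forall_le _ _ fun k hk => ?_)
  refine (natDegree_C_mul_le _ _).trans ?_
  have : (1 - X : ℂ[X]).natDegree ≤ 1 := by compute_degree
  have hk' : k < n + 2 := by simpa using hk
  exact (natDegree_pow_le_of_le k this).trans (by omega)

theorem mainTheorem7 (a : ℝ) (ha : 0 < a) (n : ℕ) :
    ∃ θ : Fin (n + 1) → ℝ → ℝ,
      (∀ b : ℝ,
        (hypergeometricPoly a b n).natDegree = n + 1 ∧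
        (hypergeometricPoly a b n).roots =
          Finset.univ.val.map (fun k => Complex.exp (θ k b * Complex.I)) ∧
        (∀ k, θ k b ∈ Set.Ioo 0 (2 * Real.pi)) ∧
        StrictMono (fun k => θ k b)) ∧
      ∀ k, Differentiable ℝ (θ k) ∧ (∀ b, deriv (θ k) b < 0) ∧ StrictAnti (θ k) := by
  obtain ⟨t, ht, ht0, htd⟩ := exists_differentiable_cotPoly_roots ha n
  -- The index is reversed because `π - 2 arctan x` decreases in `x`.
  refine ⟨fun k b => Real.pi - 2 * Real.arctan (t b k.rev), fun b => ?_, fun k => ?_⟩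
  · have hmem : ∀ k : Fin (n + 1),
        Real.pi - 2 * Real.arctan (t b k.rev) ∈ Set.Ioo 0 (2 * Real.pi) := fun k => by
      have h1 := Real.arctan_lt_pi_div_two (t b k.rev)
      have h2 := Real.neg_pi_div_two_lt_arctan (t b k.rev)
      constructor <;> linarith
    have hmono : StrictMono fun k : Fin (n + 1) => Real.pi - 2 * Real.arctan (t b k.rev) := by
      intro i j hij
      have := Real.arctan_strictMono (ht b (Fin.rev_lt_rev.2 hij))
      simp only
      linarith
    have hinj : Function.Injective fun k : Fin (n + 1) =>
        Complex.exp ((Real.pi - 2 * Real.arctan (t b k.rev) : ℝ) * Complex.I) := by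
      intro i j hij
      exact hmono.injective (exp_mul_I_injOn_Ioo (hmem i) (hmem j) hij)
    have hroot : ∀ k : Fin (n + 1), (hypergeometricPoly a b n).eval
        (Complex.exp ((Real.pi - 2 * Real.arctan (t b k.rev) : ℝ) * Complex.I)) = 0 := by
      intro k
      have hw := exp_pi_sub_two_arctan (t b k.rev)
      have h := hypergeometricSum_eq_cotPoly ha b (t b k.rev) _ hw (n + 1)
      have h3 := ascPochhammer_eval_ofReal_ne_zero (a := 2 * a) (by positivity) (n + 1)
      push_cast at h3
      have hx : ((t b k.rev : ℂ) - Complex.I) ≠ 0 := by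
        intro h0
        simp [h0] at hw
      rw [ht0, Complex.ofReal_zero, mul_eq_zero] at h
      rw [hypergeometricPoly_eval_eq_sum, h.resolve_left (mul_ne_zero (pow_ne_zero _ hx) h3),
        mul_zero]
    obtain ⟨h1, h2⟩ := roots_eq_map_univ (hypergeometricPoly_ne_zero ha b n)
      (by simpa using hypergeometricPoly_natDegree_le a b n) hinj hroot
    exact ⟨by simpa using h1, h2, hmem, hmono⟩
  · have hd : ∀ b, ∃ d < 0,
        HasDerivAt (fun b => Real.pi - 2 * Real.arctan (t b k.rev)) d b := by
      intro b
      obtain ⟨d, hd, h⟩ := htd b k.rev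
      refine ⟨_, ?_, (h.arctan.const_mul 2).const_sub Real.pi⟩
      have : 0 < 1 / (1 + t b k.rev ^ 2) * d := by positivity
      linarith
    have hneg : ∀ b, deriv (fun b => Real.pi - 2 * Real.arctan (t b k.rev)) b < 0 := by
      intro b
      obtain ⟨d, hd, h⟩ := hd b
      rwa [h.deriv]
    refine ⟨fun b => ?_, hneg, strictAnti_of_deriv_neg hneg⟩
    obtain ⟨d, -, h⟩ := hd b
    exact h.differentiableAt
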